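/- **Setting.** An MNL-bandit instance with $N$ items consists of a capacity $K\in\{1,\dots,N\}$, known rewards $r_i\in[0,1]$ and unknown preference parameters $v_i\in[0,1]$ $(i\in[N])$, with $v_0=1$. A customer who is offered $S\subseteq[N]$ buys $i\in S$ with probability $v_i/(1+\sum_{j\in S}v_j)$ and buys nothing otherwise; $R(S,\boldsymbol v)=\sum_{i\in S} r_iv_i/(1+\sum_{j\in S}v_j)$. An anytime algorithm knows $N,K,(r_i)$ but neither $\boldsymbol v$ nor a horizon; at each step $t$ it offers a (possibly random) $S_t\subseteq[N]$ with $|S_t|\le K$, whose distribution depends only on the earlier offers and the earlier customer choices. Put $$\mathrm{Reg}_T=\sum_{t=1}^{T}\Big(\max_{|S|\le K}R(S,\boldsymbol v)-R(S_t,\boldsymbol v)\Big),\qquad \Psi_T=\sum_{t=1}^{T-1}\mathbf 1[S_t\ne S_{t+1}].$$ All horizons are positive integers. **Theorem.** (a) There is a universal constant $c>0$ such that for all $C>0$ and $B>0$ there is $T_{\min}=T_{\min}(B,C)$ with the following property. Let $N\ge2$ and let $T_0\ge\max\{N,T_{\min}\}$ be an integer. If an anytime algorithm for $N$ items satisfies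 $$\mathbb E[\mathrm{Reg}_T]\le B\sqrt{NT}\,(\ln(NT))^{C}$$ on every $N$-item instance and for every $T\in[T_0,T_0^2]$, then there are an $N$-item instance and a horizon $T\in[T_0,T_0^2]$ for which $$\mathbb E[\Psi_T]\ \ge\ c\cdot\frac{N\log_2 T}{C\log_2\log_2(NT)} .$$ (b) Let $N\ge2$, let $T_0\ge\max\{4,N\}$ be an integer, and let $g$ be a function with $g(T)\in\big[\tfrac{3}{\log_2T},\tfrac12\big]$ that is non-increasing for $T\ge T_0$. For every anytime algorithm for $N$ items there are an $N$-item instance and a horizon $T\in[T_0,T_0^2]$ such that $$\mathbb E[\mathrm{Reg}_T]\ \ge\ \frac{1}{7525}\sqrt N\;T^{\frac12+\frac{g(T_0^2)}{3}}\qquad\text{or}\qquad \mathbb E[\Psi_T]\ \ge\ \frac{N}{8\log_2(1+g(T))}.$$ -/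

import Mathlib

noncomputable section

namespace MNLBandit

/-- An MNL-bandit instance with `N` items: capacity `K`, known rewards `r i ∈ [0, 1]` and
unknown preference parameters `v i ∈ [0, 1]`; the no-purchase preference is `v₀ = 1`. -/
structure Instance (N : ℕ) where
  K : ℕ
  one_le_K : 1 ≤ K
  K_le : K ≤ N
  r : Fin N → ℝ
  v : Fin N → ℝ
  r_nonneg : ∀ i, 0 ≤ r i
  r_le_one : ∀ i, r i ≤ 1
  v_nonneg : ∀ i, 0 ≤ v i
  v_le_one : ∀ i, v i ≤ 1

variable {N : ℕ}

namespace Instance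

/-- MNL choice probabilities for the offered assortment `S`; `none` is the no-purchase option. -/
def choiceProb (I : Instance N) (S : Finset (Fin N)) : Option (Fin N) → ℝ
  | none => 1 / (1 + ∑ j ∈ S, I.v j)
  | some i => if i ∈ S then I.v i / (1 + ∑ j ∈ S, I.v j) else 0

theorem denom_pos (I : Instance N) (S : Finset (Fin N)) : 0 < 1 + ∑ j ∈ S, I.v j := by
  have : 0 ≤ ∑ j ∈ S, I.v j := Finset.sum_nonneg fun i _ => I.v_nonneg i
  linarith

theorem choiceProb_nonneg (I : Instance N) (S : Finset (Fin N)) (a : Option (Fin N)) :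
    0 ≤ I.choiceProb S a := by
  have h := I.denom_pos S
  cases a with
  | none => simp only [choiceProb]; positivity
  | some i =>
    simp only [choiceProb]
    split_ifs
    · exact div_nonneg (I.v_nonneg i) h.le
    · exact le_rfl

theorem sum_choiceProb (I : Instance N) (S : Finset (Fin N)) :
    ∑ a, I.choiceProb S a = 1 := by
  have h := I.denom_pos S
  rw [Fintype.sum_option]
  simp only [choiceProb]
  rw [Finset.sum_ite_mem, Finset.univ_inter, ← Finset.sum_div, ← add_div]
  exact div_self h.ne'

/-- The law of the customer's choice when `S` is offered. -/
def choice (I : Instance N) (S : Finset (Fin N)) : PMF (Option (Fin N)) :=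
  PMF.ofFintype (fun a => ENNReal.ofReal (I.choiceProb S a)) (by
    rw [← ENNReal.ofReal_sum_of_nonneg fun a _ => I.choiceProb_nonneg S a, I.sum_choiceProb,
      ENNReal.ofReal_one])

/-- The expected reward `R(S, v) = ∑_{i ∈ S} rᵢ pᵢ(S)` of one offer of `S`. -/
def reward (I : Instance N) (S : Finset (Fin N)) : ℝ :=
  ∑ i ∈ S, I.r i * I.choiceProb S (some i)

/-- The largest expected reward over all assortments of size at most `K`. -/
def optReward (I : Instance N) : ℝ :=
  ((Finset.univ : Finset (Finset (Fin N))).filter fun S => S.card ≤ I.K).sup'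
    ⟨∅, by simp⟩ I.reward

end Instance

/-- What happens in one time step: the offered assortment and the customer's choice. -/
abbrev Obs (N : ℕ) : Type := Finset (Fin N) × Option (Fin N)

/-- A (possibly randomized) anytime algorithm for `N` items. It knows the capacity `K` and the
rewards `r`; after the first `t` steps it draws the next assortment from a distribution that
depends on the observed history only, in particular neither on `v` nor on a horizon. -/
structure AnytimeAlgorithm (N : ℕ) where
  offer : (K : ℕ) → (r : Fin N → ℝ) → (t : ℕ) → (Fin t → Obs N) → PMF (Finset (Fin N))
  card_le : ∀ K r t h, ∀ S ∈ (offer K r t h).support, S.card ≤ K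

namespace AnytimeAlgorithm

/-- The law of the history of the first `T` time steps when the algorithm runs on `I`. -/
def historyLaw (A : AnytimeAlgorithm N) (I : Instance N) : (T : ℕ) → PMF (Fin T → Obs N)
  | 0 => PMF.pure Fin.elim0
  | T + 1 =>
    (A.historyLaw I T).bind fun h =>
      (A.offer I.K I.r T h).bind fun S =>
        (I.choice S).bind fun a =>
          PMF.pure (Fin.snoc (α := fun _ => Obs N) h (S, a))

/-- Expectation of a function of the history of the first `T` steps (a finite sum). -/
def expect (A : AnytimeAlgorithm N) (I : Instance N) (T : ℕ) (f : (Fin T → Obs N) → ℝ) : ℝ :=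
  ∑ h, (A.historyLaw I T h).toReal * f h

end AnytimeAlgorithm

/-- The regret of a history of length `T`. -/
def regret (I : Instance N) {T : ℕ} (h : Fin T → Obs N) : ℝ :=
  ∑ t, (I.optReward - I.reward (h t).1)

/-- The assortment switching cost of a history of length `T`: the number of `t` with
`1 ≤ t ≤ T - 1` and `S_t ≠ S_{t+1}` (time steps are numbered from `0` here). -/
def switches {T : ℕ} (h : Fin T → Obs N) : ℕ :=
  ((Finset.univ : Finset (Fin T)).filter fun t =>
    ∃ ht : t.val + 1 < T, (h t).1 ≠ (h ⟨t.val + 1, ht⟩).1).card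

namespace AnytimeAlgorithm

/-- `𝔼[Reg_T]` of the algorithm on the instance `I`. -/
def expectedRegret (A : AnytimeAlgorithm N) (I : Instance N) (T : ℕ) : ℝ :=
  A.expect I T fun h => regret I h

/-- `𝔼[Ψ_T]`, the expected assortment switching cost before time `T` on the instance `I`. -/
def expectedSwitches (A : AnytimeAlgorithm N) (I : Instance N) (T : ℕ) : ℝ :=
  A.expect I T fun h => (switches h : ℝ)

end AnytimeAlgorithm

end MNLBandit

end

/-!
The hard instances have capacity `1` and all rewards `1`, so that they are Bernoulli bandits. On the
*uniform* instance every item is bought with probability `1 / 4`; a *raised* instance increases the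
probability of one item `i` to `1 / 4 + δ`.

Consider an epoch of steps from `n` to `n + m`, and run the algorithm on the uniform instance. If it
makes fewer than `N / 4` switches in the epoch on average, then the epoch shows at most `1 + N / 4`
distinct items on average, while the `N` items share the `n` earlier offers. By averaging, some item
`i` has been offered `O(n / N)` times before the epoch and stays unoffered throughout the epoch with
a probability that is bounded below. For `δ` of order `√(N / n)` the first `n` observations hardly
distinguish the raised instance from the uniform one, and an epoch without `i` carries no further
information. So `i` stays unoffered with constant probability on the raised instance too, at a
regret of order `m √(N / n)`: this is `exists_instance_regret_of_few_switches`. The change of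
measure (`expect_indicator_le`) avoids Pinsker's inequality: with `Λ` the log-likelihood ratio of
the first `n` steps, one takes expectations in a pointwise consequence of `1 + u ≤ exp u`. The mean
of `Λ` is a sum of divergences of single observations (`expect_sum_le_of_step`).

Now let the epochs end at `t_k = T₀ ^ ((1 + g) ^ k)`. About `1 / log₂ (1 + g)` of them fit below
`T₀ ^ 2`. Either each of them costs `N / 4` switches on the uniform instance, or one of them yields a
regret of order `√N t_{k+1} t_k ^ (-1 / 2) ≥ √N t_{k+1} ^ (1 / 2 + g / 3)`; this is
`regret_or_switches_of_const`. A non-increasing `g` is replaced by its value at `T₀ ^ 2`, and the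
bound for algorithms of nearly optimal regret comes from `g` of order
`C log₂ log₂ T₀ / log₂ T₀`.
-/

namespace MNLBandit

variable {N : ℕ}

/-! ### Expectations over histories -/

namespace AnytimeAlgorithm

theorem historyLaw_snoc (A : AnytimeAlgorithm N) (I : Instance N) {T : ℕ} (h : Fin T → Obs N)
    (o : Obs N) :
    A.historyLaw I (T + 1) (Fin.snoc (α := fun _ => Obs N) h o)
      = A.historyLaw I T h * (A.offer I.K I.r T h o.1 * I.choice o.1 o.2) := by
  classical
  obtain ⟨S, a⟩ := o
  simp only [historyLaw, PMF.bind_apply, PMF.pure_apply, tsum_fintype]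
  rw [Finset.sum_eq_single h, Finset.sum_eq_single S, Finset.sum_eq_single a]
  · simp
  · intro b _ hb
    rw [if_neg, mul_zero]
    intro e
    exact hb ((Prod.ext_iff.1 (Fin.snoc_inj.1 e).2).2).symm
  · simp
  · intro S' _ hS
    rw [Finset.sum_eq_zero, mul_zero]
    intro b _
    rw [if_neg, mul_zero]
    intro e
    exact hS ((Prod.ext_iff.1 (Fin.snoc_inj.1 e).2).1).symm
  · simp
  · intro h' _ hh
    rw [Finset.sum_eq_zero, mul_zero]
    intro S' _
    rw [Finset.sum_eq_zero, mul_zero]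
    intro b _
    rw [if_neg, mul_zero]
    intro e
    exact hh (Fin.snoc_inj.1 e).1.symm
  · simp

theorem toReal_choice (I : Instance N) (S : Finset (Fin N)) (a : Option (Fin N)) :
    (I.choice S a).toReal = I.choiceProb S a := by
  simp only [Instance.choice, PMF.ofFintype_apply]
  exact ENNReal.toReal_ofReal (I.choiceProb_nonneg S a)

theorem toReal_historyLaw_snoc (A : AnytimeAlgorithm N) (I : Instance N) {T : ℕ}
    (h : Fin T → Obs N) (o : Obs N) :
    (A.historyLaw I (T + 1) (Fin.snoc (α := fun _ => Obs N) h o)).toReal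
      = (A.historyLaw I T h).toReal *
        ((A.offer I.K I.r T h o.1).toReal * I.choiceProb o.1 o.2) := by
  rw [historyLaw_snoc, ENNReal.toReal_mul, ENNReal.toReal_mul, toReal_choice]

/-- The weight of an assortment that exceeds the capacity is zero. -/
theorem offer_eq_zero (A : AnytimeAlgorithm N) {K : ℕ} {r : Fin N → ℝ} {T : ℕ}
    {h : Fin T → Obs N} {S : Finset (Fin N)} (hS : ¬ S.card ≤ K) : A.offer K r T h S = 0 := by
  by_contra hne
  exact hS (A.card_le K r T h S ((PMF.mem_support_iff _ _).2 hne))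

/-- Histories of positive probability respect the capacity. -/
theorem card_le_of_historyLaw_ne_zero (A : AnytimeAlgorithm N) (I : Instance N) {T : ℕ}
    (h : Fin T → Obs N) (hh : A.historyLaw I T h ≠ 0) (t : Fin T) : (h t).1.card ≤ I.K := by
  induction T with
  | zero => exact t.elim0
  | succ T ih =>
    obtain ⟨h', o, rfl⟩ : ∃ h' o, h = Fin.snoc (α := fun _ => Obs N) h' o :=
      ⟨Fin.init h, h (Fin.last T), (Fin.snoc_init_self h).symm⟩
    rw [historyLaw_snoc] at hh
    have h1 := left_ne_zero_of_mul hh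
    have h2 := left_ne_zero_of_mul (right_ne_zero_of_mul hh)
    refine Fin.lastCases ?_ (fun t => ?_) t
    · rw [Fin.snoc_last]
      by_contra hS
      exact h2 (A.offer_eq_zero hS)
    · rw [Fin.snoc_castSucc]
      exact ih h' h1 t

theorem expect_succ (A : AnytimeAlgorithm N) (I : Instance N) (T : ℕ)
    (f : (Fin (T + 1) → Obs N) → ℝ) :
    A.expect I (T + 1) f = A.expect I T fun h => ∑ S, (A.offer I.K I.r T h S).toReal *
      ∑ a, I.choiceProb S a * f (Fin.snoc (α := fun _ => Obs N) h (S, a)) := by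
  unfold expect
  rw [← (Fin.snocEquiv fun _ => Obs N).sum_comp, Fintype.sum_prod_type_right]
  refine Finset.sum_congr rfl fun h _ => ?_
  rw [Finset.mul_sum, Fintype.sum_prod_type]
  refine Finset.sum_congr rfl fun S _ => ?_
  rw [Finset.mul_sum, Finset.mul_sum]
  refine Finset.sum_congr rfl fun a _ => ?_
  have := A.toReal_historyLaw_snoc I h (S, a)
  simp only [Fin.snocEquiv, Equiv.coe_fn_mk]
  rw [this]
  ring

theorem sum_toReal {α : Type*} [Fintype α] (p : PMF α) : ∑ a, (p a).toReal = 1 := by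
  rw [← ENNReal.toReal_sum fun a _ => p.apply_ne_top a, ← tsum_fintype (L := .unconditional α),
    p.tsum_coe, ENNReal.toReal_one]

@[simp] theorem expect_const (A : AnytimeAlgorithm N) (I : Instance N) (T : ℕ) (c : ℝ) :
    A.expect I T (fun _ => c) = c := by
  rw [expect, ← Finset.sum_mul, sum_toReal, one_mul]

theorem expect_add (A : AnytimeAlgorithm N) (I : Instance N) (T : ℕ)
    (f g : (Fin T → Obs N) → ℝ) :
    A.expect I T (fun h => f h + g h) = A.expect I T f + A.expect I T g := by
  simp only [expect, mul_add, Finset.sum_add_distrib]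

theorem expect_sub (A : AnytimeAlgorithm N) (I : Instance N) (T : ℕ)
    (f g : (Fin T → Obs N) → ℝ) :
    A.expect I T (fun h => f h - g h) = A.expect I T f - A.expect I T g := by
  simp only [expect, mul_sub, Finset.sum_sub_distrib]

theorem expect_const_mul (A : AnytimeAlgorithm N) (I : Instance N) (T : ℕ) (c : ℝ)
    (f : (Fin T → Obs N) → ℝ) :
    A.expect I T (fun h => c * f h) = c * A.expect I T f := by
  simp only [expect, Finset.mul_sum]
  exact Finset.sum_congr rfl fun h _ => by ring

theorem expect_sum {ι : Type*} (s : Finset ι) (A : AnytimeAlgorithm N) (I : Instance N) (T : ℕ)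
    (f : ι → (Fin T → Obs N) → ℝ) :
    A.expect I T (fun h => ∑ i ∈ s, f i h) = ∑ i ∈ s, A.expect I T (f i) := by
  simp only [expect, Finset.mul_sum]
  exact Finset.sum_comm

/-- Monotonicity of the expectation; only histories that respect the capacity matter. -/
theorem expect_mono (A : AnytimeAlgorithm N) (I : Instance N) (T : ℕ)
    {f g : (Fin T → Obs N) → ℝ}
    (hfg : ∀ h : Fin T → Obs N, (∀ t, (h t).1.card ≤ I.K) → f h ≤ g h) :
    A.expect I T f ≤ A.expect I T g := by
  refine Finset.sum_le_sum fun h _ => ?_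
  by_cases hh : A.historyLaw I T h = 0
  · simp [hh]
  · exact mul_le_mul_of_nonneg_left
      (hfg h fun t => A.card_le_of_historyLaw_ne_zero I h hh t) ENNReal.toReal_nonneg

/-- The expectation of a function of the first `n` steps does not depend on how long the
algorithm is run afterwards. -/
theorem expect_castAdd (A : AnytimeAlgorithm N) (I : Instance N) (n m : ℕ)
    (f : (Fin n → Obs N) → ℝ) :
    A.expect I (n + m) (fun h => f fun t => h (Fin.castAdd m t)) = A.expect I n f := by
  induction m with
  | zero => rfl
  | succ m ih =>
    rw [← ih]
    change A.expect I ((n + m) + 1) _ = _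
    rw [expect_succ]
    congr 1
    funext h
    have key : ∀ S a, (fun t : Fin n => (Fin.snoc (α := fun _ => Obs N) h (S, a) :
        Fin (n + m + 1) → Obs N) (Fin.castAdd (m + 1) t)) = fun t => h (Fin.castAdd m t) := by
      intro S a
      funext t
      exact Fin.snoc_castSucc (α := fun _ => Obs N) (S, a) h (Fin.castAdd m t)
    simp only [key]
    simp only [← Finset.sum_mul, Instance.sum_choiceProb, sum_toReal, one_mul]

/-- Conditioning each step on the past: a bound on the conditional mean of a function of one
observation, given the offered assortment, bounds the mean of the sum over all steps. -/
theorem expect_sum_le_of_step (A : AnytimeAlgorithm N) (I : Instance N) (T : ℕ)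
    (φ : Obs N → ℝ) (ψ : Finset (Fin N) → ℝ)
    (hstep : ∀ S : Finset (Fin N), S.card ≤ I.K → ∑ a, I.choiceProb S a * φ (S, a) ≤ ψ S) :
    A.expect I T (fun h => ∑ t, φ (h t)) ≤ A.expect I T fun h => ∑ t, ψ (h t).1 := by
  induction T with
  | zero => simp [expect]
  | succ T ih =>
    rw [expect_succ, expect_succ]
    have split : ∀ f : Obs N → ℝ,
        (A.expect I T fun h => ∑ S, (A.offer I.K I.r T h S).toReal *
          ∑ a, I.choiceProb S a *
            ∑ t, f ((Fin.snoc (α := fun _ => Obs N) h (S, a) : Fin (T + 1) → Obs N) t))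
        = A.expect I T (fun h => ∑ t, f (h t)) +
          A.expect I T fun h => ∑ S, (A.offer I.K I.r T h S).toReal *
            ∑ a, I.choiceProb S a * f (S, a) := by
      intro f
      rw [← expect_add]
      congr 1
      funext h
      simp only [Fin.sum_univ_castSucc, Fin.snoc_castSucc, Fin.snoc_last, mul_add,
        Finset.sum_add_distrib, ← Finset.sum_mul, Instance.sum_choiceProb, sum_toReal, one_mul]
    rw [split φ, split fun o => ψ o.1]
    refine add_le_add ih (A.expect_mono I T fun h _ => Finset.sum_le_sum fun S _ => ?_)
    by_cases hS : S.card ≤ I.K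
    · refine mul_le_mul_of_nonneg_left ?_ ENNReal.toReal_nonneg
      simp only [← Finset.sum_mul, Instance.sum_choiceProb, one_mul]
      exact hstep S hS
    · simp [A.offer_eq_zero hS]

/-! ### Change of measure -/

/-- Change of measure: two instances with the same capacity and rewards induce the same offers,
so the likelihood ratio of a history is the product of the likelihood ratios of the choices. -/
theorem toReal_historyLaw_eq_mul_exp (A : AnytimeAlgorithm N) (I J : Instance N)
    (hK : J.K = I.K) (hr : J.r = I.r) (l : Obs N → ℝ)
    (hl : ∀ S : Finset (Fin N), S.card ≤ I.K → ∀ a,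
      J.choiceProb S a = I.choiceProb S a * Real.exp (-l (S, a)))
    {T : ℕ} (h : Fin T → Obs N) :
    (A.historyLaw J T h).toReal
      = (A.historyLaw I T h).toReal * Real.exp (-∑ t, l (h t)) := by
  induction T with
  | zero => simp [historyLaw]
  | succ T ih =>
    obtain ⟨h', o, rfl⟩ : ∃ h' o, h = Fin.snoc (α := fun _ => Obs N) h' o :=
      ⟨Fin.init h, h (Fin.last T), (Fin.snoc_init_self h).symm⟩
    rw [toReal_historyLaw_snoc, toReal_historyLaw_snoc, ih h', hK, hr]
    simp only [Fin.sum_univ_castSucc, Fin.snoc_castSucc, Fin.snoc_last, neg_add, Real.exp_add]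
    by_cases hS : o.1.card ≤ I.K
    · rw [hl o.1 hS o.2]
      ring
    · simp [A.offer_eq_zero hS]

theorem expect_eq_expect_mul_exp (A : AnytimeAlgorithm N) (I J : Instance N)
    (hK : J.K = I.K) (hr : J.r = I.r) (l : Obs N → ℝ)
    (hl : ∀ S : Finset (Fin N), S.card ≤ I.K → ∀ a,
      J.choiceProb S a = I.choiceProb S a * Real.exp (-l (S, a)))
    (T : ℕ) (f : (Fin T → Obs N) → ℝ) :
    A.expect J T f = A.expect I T fun h => Real.exp (-∑ t, l (h t)) * f h := by
  unfold expect
  refine Finset.sum_congr rfl fun h _ => ?_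
  rw [A.toReal_historyLaw_eq_mul_exp I J hK hr l hl h, mul_assoc]

/-- An event that is likely under `I`, and on which the steps from `n` on carry no information
distinguishing `J` from `I`, cannot be unlikely under `J` unless the first `n` steps carry much
information. -/
theorem expect_indicator_le (A : AnytimeAlgorithm N) (I J : Instance N)
    (hK : J.K = I.K) (hr : J.r = I.r) (l : Obs N → ℝ)
    (hl : ∀ S : Finset (Fin N), S.card ≤ I.K → ∀ a,
      J.choiceProb S a = I.choiceProb S a * Real.exp (-l (S, a)))
    (n m : ℕ) (E : (Fin (n + m) → Obs N) → Prop) [DecidablePred E]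
    (hE : ∀ h, E h → ∀ t : Fin m, l (h (Fin.natAdd n t)) = 0) :
    A.expect I (n + m) (fun h => if E h then 1 else 0)
      ≤ A.expect I n (fun h => ∑ t, l (h t)) +
        (Real.exp 1 - 1) * A.expect J (n + m) (fun h => if E h then 1 else 0) := by
  have hone : A.expect I n (fun h => Real.exp (-∑ t, l (h t))) = 1 := by
    have := A.expect_eq_expect_mul_exp I J hK hr l hl n fun _ => 1
    simpa using this.symm
  rw [A.expect_eq_expect_mul_exp I J hK hr l hl, ← expect_castAdd A I n m,
    ← expect_const_mul]
  rw [← expect_castAdd A I n m] at hone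
  have hadd : A.expect I (n + m) (fun h =>
        (∑ t, l (h (Fin.castAdd m t)) + Real.exp (-∑ t, l (h (Fin.castAdd m t)))) +
        ((Real.exp 1 - 1) * (Real.exp (-∑ t, l (h t)) * if E h then 1 else 0) + -1))
      = A.expect I (n + m) (fun h => ∑ t, l (h (Fin.castAdd m t))) + 1 +
        (A.expect I (n + m) (fun h =>
          (Real.exp 1 - 1) * (Real.exp (-∑ t, l (h t)) * if E h then 1 else 0)) + -1) := by
    rw [expect_add, expect_add, expect_add, expect_const, hone]
  -- pointwise `1 + u ≤ exp u`, with `u = 1 - Λ` on `E` and `u = -Λ` off `E`, where `Λ` is the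
  -- log-likelihood ratio of the first `n` steps
  have hle : A.expect I (n + m) (fun h => if E h then 1 else 0) ≤
      A.expect I (n + m) (fun h =>
        (∑ t, l (h (Fin.castAdd m t)) + Real.exp (-∑ t, l (h (Fin.castAdd m t)))) +
        ((Real.exp 1 - 1) * (Real.exp (-∑ t, l (h t)) * if E h then 1 else 0) + -1)) := by
    refine A.expect_mono I (n + m) fun h _ => ?_
    by_cases hEh : E h
    · have hsum : ∑ t, l (h t) = ∑ t, l (h (Fin.castAdd m t)) := by
        rw [Fin.sum_univ_add, Finset.sum_eq_zero fun t _ => hE h hEh t, add_zero]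
      have h1 := Real.add_one_le_exp (1 + -∑ t, l (h (Fin.castAdd m t)))
      rw [Real.exp_add] at h1
      simp only [if_pos hEh, hsum]
      linarith
    · have h1 := Real.add_one_le_exp (-∑ t, l (h (Fin.castAdd m t)))
      simp only [if_neg hEh]
      linarith
  linarith

end AnytimeAlgorithm

/-! ### Bernoulli instances -/

/-- The instance with capacity `1`, all rewards `1`, and preference parameters chosen such that
an offered item `i` is bought with probability `q i`. -/
noncomputable def bernoulliInstance (hN : 1 ≤ N) (q : Fin N → ℝ) (h0 : ∀ i, 0 ≤ q i)
    (h1 : ∀ i, q i ≤ 1 / 2) : Instance N where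
  K := 1
  one_le_K := le_rfl
  K_le := hN
  r := fun _ => 1
  v := fun i => q i / (1 - q i)
  r_nonneg := fun _ => zero_le_one
  r_le_one := fun _ => le_rfl
  v_nonneg := fun i => div_nonneg (h0 i) (by linarith [h1 i])
  v_le_one := fun i => (div_le_one (by linarith [h1 i])).2 (by linarith [h1 i])

section bernoulliInstance

variable (hN : 1 ≤ N) (q : Fin N → ℝ) (h0 : ∀ i, 0 ≤ q i) (h1 : ∀ i, q i ≤ 1 / 2)

theorem choiceProb_empty (I : Instance N) (a : Option (Fin N)) :
    I.choiceProb ∅ a = if a = none then 1 else 0 := by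
  cases a <;> simp [Instance.choiceProb]

theorem bernoulliInstance_choiceProb_none (j : Fin N) :
    (bernoulliInstance hN q h0 h1).choiceProb {j} none = 1 - q j := by
  have h : (1 : ℝ) - q j ≠ 0 := by linarith [h1 j]
  simp only [Instance.choiceProb, bernoulliInstance, Finset.sum_singleton]
  field_simp
  ring

theorem bernoulliInstance_choiceProb_some (j k : Fin N) :
    (bernoulliInstance hN q h0 h1).choiceProb {j} (some k) = if k = j then q j else 0 := by
  have h : (1 : ℝ) - q j ≠ 0 := by linarith [h1 j]
  simp only [Instance.choiceProb, bernoulliInstance, Finset.sum_singleton, Finset.mem_singleton]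
  split_ifs with hk
  · subst hk
    field_simp
    ring
  · rfl

theorem bernoulliInstance_reward_singleton (j : Fin N) :
    (bernoulliInstance hN q h0 h1).reward {j} = q j := by
  rw [Instance.reward, Finset.sum_singleton, bernoulliInstance_choiceProb_some]
  simp [bernoulliInstance]

end bernoulliInstance

theorem eq_empty_or_singleton {S : Finset (Fin N)} (hS : S.card ≤ 1) :
    S = ∅ ∨ ∃ j, S = {j} := by
  rcases Nat.le_one_iff_eq_zero_or_eq_one.1 hS with h | h
  · exact Or.inl (Finset.card_eq_zero.1 h)
  · exact Or.inr (Finset.card_eq_one.1 h)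

theorem Instance.reward_le_optReward (I : Instance N) {S : Finset (Fin N)} (hS : S.card ≤ I.K) :
    I.reward S ≤ I.optReward :=
  Finset.le_sup' I.reward (by simpa using hS)

/-- The log-likelihood ratio of one observation between purchase probabilities `1 / 4` and `p`
of item `i`; observations of other items carry no information. -/
noncomputable def logRatio (i : Fin N) (p : ℝ) (o : Obs N) : ℝ :=
  if i ∈ o.1 then
    if o.2 = none then Real.log ((3 / 4) / (1 - p)) else Real.log ((1 / 4) / p)
  else 0

/-- The instance in which every item is bought with probability `1 / 4` when offered. -/
noncomputable def uniformInstance (hN : 1 ≤ N) : Instance N :=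
  bernoulliInstance hN (fun _ => 1 / 4) (fun _ => by norm_num) fun _ => by norm_num

/-- The uniform instance with the purchase probability of item `i` raised to `1 / 4 + δ`. -/
noncomputable def raisedInstance (hN : 1 ≤ N) (i : Fin N) (δ : ℝ) (hδ0 : 0 ≤ δ)
    (hδ1 : δ ≤ 1 / 4) : Instance N :=
  bernoulliInstance hN (fun j => if j = i then 1 / 4 + δ else 1 / 4)
    (fun j => by split_ifs <;> linarith)
    (fun j => by split_ifs <;> linarith)

/-- The Kullback-Leibler divergence of one observation is at most the `χ²`-divergence. -/
theorem sum_choiceProb_mul_logRatio_le (hN : 1 ≤ N) (i : Fin N) {δ : ℝ} (hδ0 : 0 ≤ δ)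
    (hδ1 : δ ≤ 1 / 4) (S : Finset (Fin N)) (hS : S.card ≤ 1) :
    ∑ a, (uniformInstance hN).choiceProb S a * logRatio i (1 / 4 + δ) (S, a)
      ≤ 8 * δ ^ 2 * if i ∈ S then 1 else 0 := by
  by_cases hi : i ∈ S
  · obtain rfl : S = {i} := by
      rcases eq_empty_or_singleton hS with rfl | ⟨j, rfl⟩
      · simp at hi
      · rw [Finset.mem_singleton.1 hi]
    rw [Fintype.sum_option]
    simp only [uniformInstance, bernoulliInstance_choiceProb_none,
      bernoulliInstance_choiceProb_some, logRatio, hi, if_true, reduceCtorEq, if_false,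
      ite_mul, zero_mul, Finset.sum_ite_eq', Finset.mem_univ, mul_one]
    have hp1 : 0 < 1 / 4 + δ := by linarith
    have hp2 : 0 < 1 - (1 / 4 + δ) := by linarith
    have l1 := Real.log_le_sub_one_of_pos (x := 3 / 4 / (1 - (1 / 4 + δ))) (by positivity)
    have l2 := Real.log_le_sub_one_of_pos (x := 1 / 4 / (1 / 4 + δ)) (by positivity)
    have key : (1 - 1 / 4) * (3 / 4 / (1 - (1 / 4 + δ)) - 1) + 1 / 4 * (1 / 4 / (1 / 4 + δ) - 1)
        = δ ^ 2 / ((1 / 4 + δ) * (1 - (1 / 4 + δ))) := by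
      have hp3 : 3 - 4 * δ ≠ 0 := by linarith
      have hp4 : 1 + 4 * δ ≠ 0 := by linarith
      rw [show (1 : ℝ) - (1 / 4 + δ) = (3 - 4 * δ) / 4 by ring,
        show (1 : ℝ) / 4 + δ = (1 + 4 * δ) / 4 by ring]
      field_simp
      ring
    have key2 : δ ^ 2 / ((1 / 4 + δ) * (1 - (1 / 4 + δ))) ≤ 8 * δ ^ 2 := by
      rw [div_le_iff₀ (by positivity)]
      have : 1 / 8 ≤ (1 / 4 + δ) * (1 - (1 / 4 + δ)) := by nlinarith
      nlinarith [sq_nonneg δ]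
    linarith
  · simp [logRatio, hi]

section raisedInstance

variable (hN : 1 ≤ N) (i : Fin N) (δ : ℝ) (hδ0 : 0 ≤ δ) (hδ1 : δ ≤ 1 / 4)

theorem raisedInstance_choiceProb (S : Finset (Fin N)) (hS : S.card ≤ 1) (a : Option (Fin N)) :
    (raisedInstance hN i δ hδ0 hδ1).choiceProb S a
      = (uniformInstance hN).choiceProb S a * Real.exp (-logRatio i (1 / 4 + δ) (S, a)) := by
  rcases eq_empty_or_singleton hS with rfl | ⟨j, rfl⟩
  · simp [choiceProb_empty, logRatio]
  · have e1 : Real.exp (-Real.log (3 / 4 / (1 - (1 / 4 + δ)))) = (1 - (1 / 4 + δ)) / (3 / 4) := by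
      rw [← Real.log_inv, inv_div, Real.exp_log]
      exact div_pos (by linarith) (by norm_num)
    have e2 : Real.exp (-Real.log (1 / 4 / (1 / 4 + δ))) = (1 / 4 + δ) / (1 / 4) := by
      rw [← Real.log_inv, inv_div, Real.exp_log]
      exact div_pos (by linarith) (by norm_num)
    rw [raisedInstance, uniformInstance]
    cases a with
    | none =>
      simp only [bernoulliInstance_choiceProb_none, logRatio, Finset.mem_singleton, if_true]
      by_cases hj : j = i
      · subst hj
        simp only [if_true, e1]
        ring
      · rw [if_neg hj, if_neg (Ne.symm hj)]
        norm_num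
    | some k =>
      simp only [bernoulliInstance_choiceProb_some, logRatio, Finset.mem_singleton]
      by_cases hj : j = i
      · subst hj
        simp only [if_true, reduceCtorEq, if_false, e2]
        split_ifs <;> ring
      · rw [if_neg hj, if_neg (Ne.symm hj)]
        norm_num

theorem raisedInstance_le_optReward : 1 / 4 + δ ≤ (raisedInstance hN i δ hδ0 hδ1).optReward := by
  have := (raisedInstance hN i δ hδ0 hδ1).reward_le_optReward (S := {i})
    (by simp [raisedInstance, bernoulliInstance])
  have hreward : (raisedInstance hN i δ hδ0 hδ1).reward {i} = 1 / 4 + δ := by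
    rw [raisedInstance, bernoulliInstance_reward_singleton, if_pos rfl]
  rwa [hreward] at this

theorem raisedInstance_reward_le (S : Finset (Fin N)) (hS : S.card ≤ 1) (hi : i ∉ S) :
    (raisedInstance hN i δ hδ0 hδ1).reward S ≤ 1 / 4 := by
  rcases eq_empty_or_singleton hS with rfl | ⟨j, rfl⟩
  · simp [Instance.reward]
  · rw [raisedInstance, bernoulliInstance_reward_singleton, if_neg]
    rintro rfl
    simp at hi

/-- Each step that does not offer the raised item costs `δ`. -/
theorem le_expectedRegret_raisedInstance (A : AnytimeAlgorithm N) (n m : ℕ)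
    (E : (Fin (n + m) → Obs N) → Prop) [DecidablePred E]
    (hE : ∀ h, E h → ∀ t : Fin m, i ∉ (h (Fin.natAdd n t)).1) :
    m * δ * A.expect (raisedInstance hN i δ hδ0 hδ1) (n + m) (fun h => if E h then 1 else 0)
      ≤ A.expectedRegret (raisedInstance hN i δ hδ0 hδ1) (n + m) := by
  set J := raisedInstance hN i δ hδ0 hδ1 with hJ
  have hK : J.K = 1 := rfl
  rw [← A.expect_const_mul]
  refine A.expect_mono J (n + m) fun h hcard => ?_
  have hnn : ∀ t, 0 ≤ J.optReward - J.reward (h t).1 := fun t =>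
    sub_nonneg.2 (J.reward_le_optReward (hcard t))
  by_cases hEh : E h
  · rw [if_pos hEh, mul_one, regret, Fin.sum_univ_add]
    have hge : ∑ _t : Fin m, δ
        ≤ ∑ t : Fin m, (J.optReward - J.reward (h (Fin.natAdd n t)).1) := by
      refine Finset.sum_le_sum fun t _ => ?_
      have h1 := raisedInstance_le_optReward hN i δ hδ0 hδ1
      have h2 := raisedInstance_reward_le hN i δ hδ0 hδ1 _ (hcard (Fin.natAdd n t)) (hE h hEh t)
      rw [← hJ] at h1 h2
      linarith
    rw [Finset.sum_const, Finset.card_univ, Fintype.card_fin, nsmul_eq_mul] at hge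
    have := Finset.sum_nonneg fun (t : Fin n) (_ : t ∈ Finset.univ) => hnn (Fin.castAdd m t)
    linarith
  · rw [if_neg hEh, mul_zero]
    exact Finset.sum_nonneg fun t _ => hnn t

end raisedInstance

/-! ### Switches and the number of offered items -/

/-- A sequence of at most singleton sets shows at most one more element than it has jumps. -/
theorem card_biUnion_le_one_add_card_jumps (s : ℕ → Finset (Fin N)) (hs : ∀ t, (s t).card ≤ 1)
    (n m : ℕ) :
    ((Finset.Ico n (n + m)).biUnion s).card
      ≤ 1 + ((Finset.Ico n (n + m)).filter fun t => t + 1 < n + m ∧ s t ≠ s (t + 1)).card := by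
  induction m with
  | zero => simp
  | succ m ih =>
    rcases Nat.eq_zero_or_pos m with rfl | hm
    · simpa using (hs n).trans (Nat.le_add_right _ _)
    obtain ⟨u, hu⟩ : ∃ u, n + m = u + 1 := ⟨n + m - 1, by omega⟩
    have hIco : Finset.Ico n (n + (m + 1)) = insert (u + 1) (Finset.Ico n (n + m)) := by
      ext t
      simp only [Finset.mem_Ico, Finset.mem_insert]
      omega
    have hu_mem : u ∈ Finset.Ico n (n + m) := Finset.mem_Ico.2 (by omega)
    have hsub : ((Finset.Ico n (n + m)).filter fun t => t + 1 < n + m ∧ s t ≠ s (t + 1))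
        ⊆ (Finset.Ico n (n + (m + 1))).filter fun t => t + 1 < n + (m + 1) ∧ s t ≠ s (t + 1) := by
      intro t
      simp only [Finset.mem_filter, Finset.mem_Ico]
      rintro ⟨_, _, _⟩
      refine ⟨by omega, by omega, by assumption⟩
    rw [hIco, Finset.biUnion_insert, ← hIco]
    by_cases hjump : s u = s (u + 1)
    · rw [← hjump, Finset.union_eq_right.2 (Finset.subset_biUnion_of_mem s hu_mem)]
      exact ih.trans (Nat.add_le_add_left (Finset.card_le_card hsub) 1)
    · have hlt : ((Finset.Ico n (n + m)).filter fun t => t + 1 < n + m ∧ s t ≠ s (t + 1)).card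
          < ((Finset.Ico n (n + (m + 1))).filter
            fun t => t + 1 < n + (m + 1) ∧ s t ≠ s (t + 1)).card := by
        refine Finset.card_lt_card ((Finset.ssubset_iff_of_subset hsub).2 ⟨u, ?_, ?_⟩)
        · simp only [Finset.mem_filter, Finset.mem_Ico] at hu_mem ⊢
          exact ⟨by omega, by omega, hjump⟩
        · simp only [Finset.mem_filter]
          omega
      have := Finset.card_union_le (s (u + 1)) ((Finset.Ico n (n + m)).biUnion s)
      have := hs (u + 1)
      omega

theorem switches_eq_card {T : ℕ} (h : Fin T → Obs N) (s : ℕ → Finset (Fin N))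
    (hs : ∀ t : Fin T, s t = (h t).1) :
    switches h = ((Finset.range T).filter fun t => t + 1 < T ∧ s t ≠ s (t + 1)).card := by
  rw [switches, ← Finset.card_map Fin.valEmbedding]
  congr 1
  ext t
  simp only [Finset.mem_map, Finset.mem_filter, Finset.mem_univ, true_and, Fin.valEmbedding_apply,
    Finset.mem_range]
  constructor
  · rintro ⟨u, ⟨hu, hne⟩, rfl⟩
    rw [← hs u, ← hs ⟨u + 1, hu⟩] at hne
    exact ⟨u.2, hu, hne⟩
  · rintro ⟨ht, ht', hne⟩
    rw [hs ⟨t, ht⟩, hs ⟨t + 1, ht'⟩] at hne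
    exact ⟨⟨t, ht⟩, ⟨ht', hne⟩, rfl⟩

/-- The number of distinct items offered from step `n` on is at most one more than the number of
switches made in those steps. -/
theorem card_offered_add_switches_le (n m : ℕ) (h : Fin (n + m) → Obs N)
    (hcard : ∀ t, (h t).1.card ≤ 1) :
    (Finset.univ.filter fun i : Fin N => ∃ t : Fin m, i ∈ (h (Fin.natAdd n t)).1).card
      + switches (fun t => h (Fin.castAdd m t)) ≤ 1 + switches h := by
  set s : ℕ → Finset (Fin N) := fun t => if ht : t < n + m then (h ⟨t, ht⟩).1 else ∅ with hsdef
  have hs : ∀ t : Fin (n + m), s t = (h t).1 := fun t => by simp [hsdef]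
  have hs1 : ∀ t, (s t).card ≤ 1 := by
    intro t
    simp only [hsdef]
    split_ifs
    · exact hcard _
    · simp
  rw [switches_eq_card h s hs, switches_eq_card (fun t => h (Fin.castAdd m t)) s
    fun t => hs (Fin.castAdd m t)]
  have h1 := card_biUnion_le_one_add_card_jumps s hs1 n m
  have h2 : (Finset.univ.filter fun i : Fin N => ∃ t : Fin m, i ∈ (h (Fin.natAdd n t)).1)
      ⊆ (Finset.Ico n (n + m)).biUnion s := by
    intro i hi
    simp only [Finset.mem_filter, Finset.mem_univ, true_and] at hi
    obtain ⟨t, ht⟩ := hi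
    refine Finset.mem_biUnion.2 ⟨n + t, Finset.mem_Ico.2 (by omega), ?_⟩
    rw [← hs (Fin.natAdd n t)] at ht
    exact ht
  have h3 : Disjoint ((Finset.range n).filter fun t => t + 1 < n ∧ s t ≠ s (t + 1))
      ((Finset.Ico n (n + m)).filter fun t => t + 1 < n + m ∧ s t ≠ s (t + 1)) := by
    refine Finset.disjoint_left.2 fun t ht ht' => ?_
    simp only [Finset.mem_filter, Finset.mem_range, Finset.mem_Ico] at ht ht'
    omega
  have h4 : ((Finset.range n).filter fun t => t + 1 < n ∧ s t ≠ s (t + 1)) ∪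
      ((Finset.Ico n (n + m)).filter fun t => t + 1 < n + m ∧ s t ≠ s (t + 1))
      ⊆ (Finset.range (n + m)).filter fun t => t + 1 < n + m ∧ s t ≠ s (t + 1) := by
    intro t
    simp only [Finset.mem_union, Finset.mem_filter, Finset.mem_range, Finset.mem_Ico]
    rintro (⟨_, _, _⟩ | ⟨_, _, _⟩) <;> refine ⟨by omega, by omega, by assumption⟩
  have h5 := Finset.card_le_card h4
  rw [Finset.card_union_of_disjoint h3] at h5
  have h6 := Finset.card_le_card h2
  omega

/-! ### One epoch -/

/-- If few switches are expected on the uniform instance during the steps from `n` to `n + m`,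
then raising the purchase probability of some item goes unnoticed for long: the algorithm misses the
item during the whole epoch with probability at least `1 / 16`. -/
theorem exists_instance_regret_of_few_switches (hN : 2 ≤ N) (A : AnytimeAlgorithm N) (n m : ℕ)
    (hNn : N ≤ n)
    (hfew : A.expectedSwitches (uniformInstance (by omega)) (n + m)
      - A.expectedSwitches (uniformInstance (by omega)) n < (N : ℝ) / 4) :
    ∃ I : Instance N, m * Real.sqrt ((N : ℝ) / n) / 128 ≤ A.expectedRegret I (n + m) := by
  classical
  have hN1 : 1 ≤ N := by omega
  have hN0 : (2 : ℝ) ≤ N := by exact_mod_cast hN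
  have hn0 : (0 : ℝ) < n := by exact_mod_cast (by omega : 0 < n)
  have hNn' : (N : ℝ) ≤ n := by exact_mod_cast hNn
  set I₀ : Instance N := uniformInstance hN1 with hI₀
  have hK₀ : I₀.K = 1 := rfl
  set x : Fin N → ℝ := fun i => A.expect I₀ n fun h => ∑ t, if i ∈ (h t).1 then 1 else 0 with hx
  set p : Fin N → ℝ := fun i => A.expect I₀ (n + m) fun h =>
    if ∃ t : Fin m, i ∈ (h (Fin.natAdd n t)).1 then 1 else 0 with hp
  have hsumx : ∑ i, x i ≤ n := by
    rw [hx, ← A.expect_sum, ← A.expect_const I₀ n (n : ℝ)]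
    refine A.expect_mono I₀ n fun h hcard => ?_
    rw [Finset.sum_comm]
    calc ∑ t, ∑ i, (if i ∈ (h t).1 then (1 : ℝ) else 0) ≤ ∑ _t : Fin n, (1 : ℝ) := by
          refine Finset.sum_le_sum fun t _ => ?_
          rw [Finset.sum_boole]
          have := hcard t
          rw [hK₀] at this
          simpa using this
      _ = n := by simp
  have hsump : ∑ i, p i ≤ 1 + (N : ℝ) / 4 := by
    have hle : ∑ i, p i ≤ A.expect I₀ (n + m) fun h =>
        (1 + (switches h : ℝ)) - (switches fun t => h (Fin.castAdd m t) : ℕ) := by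
      rw [hp, ← A.expect_sum]
      refine A.expect_mono I₀ (n + m) fun h hcard => ?_
      rw [Finset.sum_boole, le_sub_iff_add_le]
      exact_mod_cast card_offered_add_switches_le n m h hcard
    rw [A.expect_sub, A.expect_add, A.expect_const,
      A.expect_castAdd I₀ n m fun h => ((switches h : ℕ) : ℝ)] at hle
    unfold AnytimeAlgorithm.expectedSwitches at hfew
    linarith
  -- The average over the items is at most `1 / N + 1 / 4 + 1 / 8`, and `N ≥ 2`. The same weight
  -- `N / (8 n)` is the divergence per offer for the `δ` below, so that the two terms cancel.
  obtain ⟨i, hi⟩ : ∃ i, p i + x i * (N / (8 * n)) ≤ 7 / 8 := by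
    have hne : (Finset.univ : Finset (Fin N)).Nonempty := ⟨⟨0, by omega⟩, Finset.mem_univ _⟩
    have : ∑ i, (p i + x i * (N / (8 * n))) ≤ ∑ _i : Fin N, (7 / 8 : ℝ) := by
      rw [Finset.sum_add_distrib, ← Finset.sum_mul, Finset.sum_const, Finset.card_univ,
        Fintype.card_fin, nsmul_eq_mul]
      have h1 : (∑ i, x i) * (N / (8 * n)) ≤ n * (N / (8 * n)) :=
        mul_le_mul_of_nonneg_right hsumx (by positivity)
      have h2 : (n : ℝ) * (N / (8 * n)) = N / 8 := by field_simp
      linarith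
    obtain ⟨i, _, hi⟩ := Finset.exists_le_of_sum_le hne this
    exact ⟨i, hi⟩
  set δ : ℝ := Real.sqrt ((N : ℝ) / n) / 8 with hδ
  have hδ0 : 0 ≤ δ := by positivity
  have hδ1 : δ ≤ 1 / 4 := by
    have : Real.sqrt ((N : ℝ) / n) ≤ 1 :=
      Real.sqrt_le_one.2 ((div_le_one hn0).2 hNn')
    rw [hδ]
    linarith
  have hδsq : 8 * δ ^ 2 = N / (8 * n) := by
    rw [hδ, div_pow, Real.sq_sqrt (by positivity)]
    field_simp
  set J := raisedInstance hN1 i δ hδ0 hδ1 with hJ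
  set E : (Fin (n + m) → Obs N) → Prop := fun h => ¬ ∃ t : Fin m, i ∈ (h (Fin.natAdd n t)).1
    with hE
  have hinfo : A.expect I₀ n (fun h => ∑ t, logRatio i (1 / 4 + δ) (h t))
      ≤ x i * (N / (8 * n)) := by
    refine (A.expect_sum_le_of_step I₀ n _ _
      fun S hS => sum_choiceProb_mul_logRatio_le hN1 i hδ0 hδ1 S hS).trans_eq ?_
    simp only [← Finset.mul_sum]
    rw [A.expect_const_mul, hδsq, mul_comm]
  have hchange := A.expect_indicator_le I₀ J rfl rfl (logRatio i (1 / 4 + δ))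
    (fun S hS a => raisedInstance_choiceProb hN1 i δ hδ0 hδ1 S hS a) n m E
    (fun h hEh t => if_neg fun hmem => hEh ⟨t, hmem⟩)
  have hEp : A.expect I₀ (n + m) (fun h => if E h then 1 else 0) = 1 - p i := by
    rw [hp, ← A.expect_const I₀ (n + m) 1, ← A.expect_sub]
    congr 1
    funext h
    simp only [hE]
    split_ifs <;> simp
  have hreg := le_expectedRegret_raisedInstance hN1 i δ hδ0 hδ1 A n m E
    (fun h hEh t hmem => hEh ⟨t, hmem⟩)
  rw [← hJ] at hreg
  set Q := A.expect J (n + m) (fun h => if E h then 1 else 0) with hQ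
  have hQ0 : 0 ≤ Q := by
    rw [hQ, ← A.expect_const J (n + m) 0]
    exact A.expect_mono J (n + m) fun h _ => by split_ifs <;> norm_num
  have hQ1 : 1 / 16 ≤ Q := by
    have he := Real.exp_one_lt_d9
    nlinarith
  refine ⟨J, le_trans ?_ hreg⟩
  have hmul : (m : ℝ) * δ * (1 / 16) ≤ m * δ * Q :=
    mul_le_mul_of_nonneg_left hQ1 (by positivity)
  have : (m : ℝ) * Real.sqrt ((N : ℝ) / n) / 128 = m * δ * (1 / 16) := by
    rw [hδ]
    ring
  linarith

/-! ### Epochs of growing length -/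

/-- The end `x ^ (1 + g)` of an epoch is far enough from its start `x` that, also after rounding,
the epoch makes up a constant fraction of the horizon. -/
theorem two_and_half_mul_le_rpow {a x g : ℝ} (ha : 1 < a) (hax : a ≤ x) (hg : 0 ≤ g)
    (hga : 3 / 2 ≤ g * Real.logb 2 a) : 5 / 2 * x ≤ x ^ (1 + g) := by
  have hx : 0 < x := by linarith
  have h1 : (5 / 2 : ℝ) ≤ a ^ g := by
    have : a ^ g = 2 ^ (g * Real.logb 2 a) := by
      rw [mul_comm, Real.rpow_mul (by norm_num), Real.rpow_logb (by norm_num) (by norm_num)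
        (by linarith)]
    rw [this]
    refine le_trans ?_ (Real.rpow_le_rpow_of_exponent_le (by norm_num) hga)
    have hsq : ((2 : ℝ) ^ (3 / 2 : ℝ)) ^ 2 = 8 := by
      rw [← Real.rpow_natCast, ← Real.rpow_mul (by norm_num)]
      norm_num
    exact le_of_sq_le_sq (by rw [hsq]; norm_num) (by positivity)
  rw [Real.rpow_add hx, Real.rpow_one, mul_comm x]
  exact mul_le_mul_of_nonneg_right
    (h1.trans (Real.rpow_le_rpow (by linarith) hax hg)) hx.le

/-- The regret collected in an epoch from `⌊x⌋` to `⌊x ^ (1 + g)⌋`, in terms of its end. -/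
theorem epoch_regret_bound {x g c : ℝ} (hc : 0 ≤ c) (hx : 4 ≤ x) (hg0 : 0 ≤ g) (hg1 : g ≤ 1 / 2)
    (hgrow : 5 / 2 * x ≤ x ^ (1 + g)) :
    1 / 256 * Real.sqrt c * (⌊x ^ (1 + g)⌋₊ : ℝ) ^ (1 / 2 + g / 3)
      ≤ ((⌊x ^ (1 + g)⌋₊ - ⌊x⌋₊ : ℕ) : ℝ) * Real.sqrt (c / ⌊x⌋₊) / 128 := by
  have hx0 : 0 < x := by linarith
  set y := x ^ (1 + g) with hy
  have hy0 : 0 ≤ y := by positivity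
  have hxy : x ≤ y := by linarith
  have hfx : (⌊x⌋₊ : ℝ) ≤ x := Nat.floor_le hx0.le
  have hfy : (⌊y⌋₊ : ℝ) ≤ y := Nat.floor_le hy0
  have hfy' : y < ⌊y⌋₊ + 1 := Nat.lt_floor_add_one y
  have hfx0 : (0 : ℝ) < ⌊x⌋₊ := Nat.cast_pos.2 (Nat.floor_pos.2 (by linarith))
  have hm : y / 2 ≤ ((⌊y⌋₊ - ⌊x⌋₊ : ℕ) : ℝ) := by
    rw [Nat.cast_sub (Nat.floor_le_floor hxy)]
    linarith
  have hs : Real.sqrt c * x ^ (-(1 / 2) : ℝ) ≤ Real.sqrt (c / ⌊x⌋₊) := by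
    rw [Real.rpow_neg hx0.le, ← Real.sqrt_eq_rpow, ← div_eq_mul_inv, ← Real.sqrt_div hc]
    exact Real.sqrt_le_sqrt (div_le_div_of_nonneg_left hc hfx0 hfx)
  have hpow : (⌊y⌋₊ : ℝ) ^ (1 / 2 + g / 3) ≤ y * x ^ (-(1 / 2) : ℝ) := by
    refine (Real.rpow_le_rpow (by positivity) hfy (by positivity)).trans ?_
    rw [hy, ← Real.rpow_mul hx0.le, ← Real.rpow_add hx0]
    exact Real.rpow_le_rpow_of_exponent_le (by linarith) (by nlinarith)
  have hprod := mul_le_mul hm hs (by positivity) (by positivity)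
  have := mul_le_mul_of_nonneg_left hpow (Real.sqrt_nonneg c)
  linarith

/-- The trade-off between regret and switches with a constant epoch exponent `g`. -/
theorem regret_or_switches_of_const (hN : 2 ≤ N) {T₀ : ℕ} (hT₀ : 4 ≤ T₀) (hNT₀ : N ≤ T₀) {g : ℝ}
    (hg0 : 0 < g) (hg1 : g ≤ 1 / 2) (hgT₀ : 3 / 2 ≤ g * Real.logb 2 (T₀ : ℝ))
    (A : AnytimeAlgorithm N) :
    ∃ (I : Instance N) (T : ℕ), T₀ ≤ T ∧ T ≤ T₀ ^ 2 ∧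
      (1 / 256 * Real.sqrt (N : ℝ) * (T : ℝ) ^ ((1 : ℝ) / 2 + g / 3) ≤ A.expectedRegret I T ∨
        (N : ℝ) / (8 * Real.logb 2 (1 + g)) ≤ A.expectedSwitches I T) := by
  have ha4 : (4 : ℝ) ≤ T₀ := by exact_mod_cast hT₀
  set t : ℕ → ℝ := fun k => (T₀ : ℝ) ^ ((1 + g) ^ k) with ht
  set L := Real.logb 2 (1 + g) with hL
  have hL0 : 0 < L := Real.logb_pos (by norm_num) (by linarith)
  have hL1 : L ≤ 1 := by
    rw [← Real.logb_self_eq_one (b := 2) (by norm_num)]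
    exact Real.logb_le_logb_of_le (by norm_num) (by linarith) (by linarith)
  set M := ⌊1 / L⌋₊ with hM
  have hM1 : 1 ≤ M := Nat.one_le_floor_iff _ |>.2 ((one_le_div hL0).2 hL1)
  have hM2 : 1 / L ≤ 2 * M := by
    have h1 := Nat.lt_floor_add_one (1 / L)
    have h2 : (1 : ℝ) ≤ M := by exact_mod_cast hM1
    rw [← hM] at h1
    linarith
  have hML : M * L ≤ 1 := (le_div_iff₀ hL0).1 (Nat.floor_le (by positivity))
  have hpowM : (1 + g) ^ M ≤ 2 := by
    rw [← Real.logb_le_logb (b := 2) (by norm_num) (by positivity) (by norm_num),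
      Real.logb_pow, Real.logb_self_eq_one (by norm_num)]
    exact hML
  have htmono : Monotone t := fun j k hjk =>
    Real.rpow_le_rpow_of_exponent_le (by linarith) (pow_le_pow_right₀ (by linarith) hjk)
  have ht0 : t 0 = T₀ := by simp [ht]
  have hsucc : ∀ k, t (k + 1) = t k ^ (1 + g) := by
    intro k
    simp only [ht]
    rw [← Real.rpow_mul (by linarith), pow_succ]
  have hge : ∀ k, (T₀ : ℝ) ≤ t k := fun k => ht0 ▸ htmono (Nat.zero_le k)
  have htM : t M ≤ (T₀ : ℝ) ^ 2 := by
    rw [← Real.rpow_two]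
    exact Real.rpow_le_rpow_of_exponent_le (by linarith) hpowM
  have hlow : ∀ k, T₀ ≤ ⌊t k⌋₊ := fun k => Nat.le_floor (hge k)
  have hupp : ∀ k, k ≤ M → ⌊t k⌋₊ ≤ T₀ ^ 2 := fun k hk =>
    Nat.floor_le_of_le (by exact_mod_cast (htmono hk).trans htM)
  set D : ℕ → ℝ := fun k => A.expectedSwitches (uniformInstance (by omega)) ⌊t k⌋₊ with hD
  -- the differences telescope, so that large ones in all epochs add up to the switches until `t M`
  by_cases hex : ∃ k < M, D (k + 1) - D k < (N : ℝ) / 4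
  · obtain ⟨k, hk, hfew⟩ := hex
    have hle : ⌊t k⌋₊ ≤ ⌊t (k + 1)⌋₊ := Nat.floor_le_floor (htmono (Nat.le_succ k))
    have hadd : ⌊t k⌋₊ + (⌊t (k + 1)⌋₊ - ⌊t k⌋₊) = ⌊t (k + 1)⌋₊ := Nat.add_sub_cancel' hle
    obtain ⟨I, hI⟩ := exists_instance_regret_of_few_switches hN A ⌊t k⌋₊
      (⌊t (k + 1)⌋₊ - ⌊t k⌋₊) (hNT₀.trans (hlow k)) (by rw [hadd]; exact hfew)
    rw [hadd] at hI
    refine ⟨I, _, hlow (k + 1), hupp (k + 1) hk, Or.inl (le_trans ?_ hI)⟩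
    rw [hsucc k]
    exact epoch_regret_bound (Nat.cast_nonneg N) (ha4.trans (hge k)) hg0.le hg1
      (two_and_half_mul_le_rpow (by linarith) (hge k) hg0.le hgT₀)
  · push Not at hex
    refine ⟨uniformInstance (by omega), ⌊t M⌋₊, hlow M, hupp M le_rfl, Or.inr ?_⟩
    change _ ≤ D M
    have hsum : (M : ℝ) * (N / 4) ≤ D M - D 0 := by
      rw [← Finset.sum_range_sub D M]
      have := Finset.card_nsmul_le_sum (Finset.range M) (fun k => D (k + 1) - D k) ((N : ℝ) / 4)
        fun k hk => hex k (Finset.mem_range.1 hk)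
      simpa using this
    have hD0 : 0 ≤ D 0 := by
      simp only [hD]
      rw [AnytimeAlgorithm.expectedSwitches,
        ← A.expect_const (uniformInstance (by omega)) ⌊t 0⌋₊ 0]
      exact A.expect_mono _ _ fun h _ => Nat.cast_nonneg _
    have hform : (N : ℝ) / (8 * L) = N / 8 * (1 / L) := by field_simp
    rw [hform]
    have := mul_le_mul_of_nonneg_left hM2 (by positivity : (0 : ℝ) ≤ N / 8)
    linarith

/-! ### Choice of the epoch exponent -/

/-- The asymptotic facts about `y = log₂ T₀` that make `g = 6 C log₂ y / y` an admissible epoch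
exponent whose regret lower bound exceeds the assumed upper bound. -/
theorem eventually_exponent_admissible {C : ℝ} (hC : 0 < C) (B : ℝ) :
    ∀ᶠ T₀ : ℕ in Filter.atTop, 2 ≤ Real.logb 2 (T₀ : ℝ) ∧
      1 / C ≤ Real.logb 2 (Real.logb 2 (T₀ : ℝ)) ∧
      6 * C * Real.logb 2 (Real.logb 2 (T₀ : ℝ)) / Real.logb 2 (T₀ : ℝ) ≤ 1 / 2 ∧
      256 * B * 3 ^ C < Real.logb 2 (T₀ : ℝ) ^ C := by
  have hlim : Filter.Tendsto (fun T₀ : ℕ => Real.logb 2 (T₀ : ℝ)) Filter.atTop Filter.atTop :=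
    (Real.tendsto_logb_atTop (by norm_num)).comp tendsto_natCast_atTop_atTop
  refine hlim.eventually (p := fun y => 2 ≤ y ∧ 1 / C ≤ Real.logb 2 y ∧
    6 * C * Real.logb 2 y / y ≤ 1 / 2 ∧ 256 * B * 3 ^ C < y ^ C) ?_
  have hlog : Filter.Tendsto (fun y : ℝ => 6 * C * Real.logb 2 y / y) Filter.atTop (nhds 0) := by
    have h := (Real.isLittleO_log_id_atTop.tendsto_div_nhds_zero).const_mul (6 * C / Real.log 2)
    rw [mul_zero] at h
    refine h.congr fun y => ?_
    simp only [Real.logb, id]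
    ring
  filter_upwards [Filter.eventually_ge_atTop 2,
    (Real.tendsto_logb_atTop (b := 2) (by norm_num)).eventually_ge_atTop (1 / C),
    hlog.eventually_le_const (by norm_num : (0 : ℝ) < 1 / 2),
    (tendsto_rpow_atTop hC).eventually_gt_atTop (256 * B * 3 ^ C)] with y h1 h2 h3 h4
  exact ⟨h1, h2, h3, h4⟩

/-- A regret bound of order `√(N T)` up to a power of the logarithm excludes the first alternative
of `regret_or_switches_of_const` for the exponent `g = 6 C log₂ log₂ T₀ / log₂ T₀`: then
`T ^ (g / 3) ≥ (log₂ T₀) ^ (2 C)` beats `B (log (N T)) ^ C`. -/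
theorem exists_switches_of_regret_le {C : ℝ} (hC : 0 < C) {B : ℝ} (hB : 0 < B) :
    ∃ Tmin : ℕ, ∀ N : ℕ, 2 ≤ N → ∀ A : AnytimeAlgorithm N,
      ∀ T₀ : ℕ, Tmin ≤ T₀ → N ≤ T₀ →
      (∀ (I : Instance N) (T : ℕ), T₀ ≤ T → T ≤ T₀ ^ 2 →
        A.expectedRegret I T
          ≤ B * Real.sqrt ((N : ℝ) * (T : ℝ)) * Real.log ((N : ℝ) * (T : ℝ)) ^ C) →
      ∃ (I : Instance N) (T : ℕ), T₀ ≤ T ∧ T ≤ T₀ ^ 2 ∧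
        1 / 192 * ((N : ℝ) * Real.logb 2 (T : ℝ)
            / (C * Real.logb 2 (Real.logb 2 ((N : ℝ) * (T : ℝ)))))
          ≤ A.expectedSwitches I T := by
  obtain ⟨T₁, hT₁⟩ := Filter.eventually_atTop.1 (eventually_exponent_admissible hC B)
  refine ⟨max 4 T₁, fun N hN A T₀ hTmin hNT₀ hreg => ?_⟩
  have hT₀ : 4 ≤ T₀ := (le_max_left _ _).trans hTmin
  obtain ⟨hy2, hlC, hg1, hbig⟩ := hT₁ T₀ ((le_max_right _ _).trans hTmin)
  set y := Real.logb 2 (T₀ : ℝ) with hy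
  set l := Real.logb 2 y with hl
  set g := 6 * C * l / y with hg
  have hy0 : 0 < y := by linarith
  have hl0 : 0 < l := lt_of_lt_of_le (by positivity) hlC
  have hg0 : 0 < g := by positivity
  have hgy : g * y = 6 * C * l := by rw [hg]; field_simp
  have hCl : 1 ≤ C * l := by
    have := mul_le_mul_of_nonneg_left hlC hC.le
    rwa [mul_one_div_cancel hC.ne'] at this
  have hT₀r : (4 : ℝ) ≤ T₀ := by exact_mod_cast hT₀
  have hNr : (2 : ℝ) ≤ N := by exact_mod_cast hN
  have hNT₀r : (N : ℝ) ≤ T₀ := by exact_mod_cast hNT₀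
  obtain ⟨I, T, hT0, hT2, hor⟩ := regret_or_switches_of_const hN hT₀ hNT₀ hg0 hg1
    (by rw [← hy, hgy]; linarith) A
  refine ⟨I, T, hT0, hT2, ?_⟩
  have hT0r : (T₀ : ℝ) ≤ T := by exact_mod_cast hT0
  have hT2r : (T : ℝ) ≤ (T₀ : ℝ) ^ 2 := by exact_mod_cast hT2
  have hTpos : (0 : ℝ) < T := by linarith
  rcases hor with hlarge | hsw
  · exfalso
    have hub := hlarge.trans (hreg I T hT0 hT2)
    rw [Real.sqrt_mul (by linarith), Real.rpow_add hTpos, ← Real.sqrt_eq_rpow] at hub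
    have hlog : Real.log ((N : ℝ) * T) ≤ 3 * y := by
      have h1 : (N : ℝ) * T ≤ (T₀ : ℝ) ^ 3 := by
        calc (N : ℝ) * T ≤ T₀ * (T₀ : ℝ) ^ 2 :=
              mul_le_mul hNT₀r hT2r hTpos.le (by linarith)
          _ = (T₀ : ℝ) ^ 3 := by ring
      have h2 := Real.log_le_log (by positivity) h1
      rw [Real.log_pow] at h2
      have h3 : Real.log T₀ ≤ y := by
        rw [hy, Real.logb, le_div_iff₀ (Real.log_pos (by norm_num))]
        have := Real.log_two_lt_d9
        nlinarith [Real.log_nonneg (by linarith : (1 : ℝ) ≤ T₀)]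
      push_cast at h2
      linarith
    have hlogC : Real.log ((N : ℝ) * T) ^ C ≤ 3 ^ C * y ^ C := by
      rw [← Real.mul_rpow (by norm_num) hy0.le]
      exact Real.rpow_le_rpow (Real.log_nonneg (by nlinarith)) hlog hC.le
    have hTg : y ^ C * y ^ C ≤ (T : ℝ) ^ (g / 3) := by
      refine le_trans (le_of_eq ?_) (Real.rpow_le_rpow (by linarith) hT0r (by positivity))
      have e1 : (T₀ : ℝ) = 2 ^ y :=
        (Real.rpow_logb (by norm_num) (by norm_num) (by linarith)).symm
      have e2 : y = 2 ^ l := (Real.rpow_logb (by norm_num) (by norm_num) hy0).symm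
      rw [e1, ← Real.rpow_mul (by norm_num), show y * (g / 3) = l * C + l * C by linarith,
        Real.rpow_add (by norm_num), Real.rpow_mul (by norm_num), ← e2]
    have hyC : 0 < y ^ C := by positivity
    have hs : 0 < Real.sqrt N * Real.sqrt T := by positivity
    have hub' : (Real.sqrt N * Real.sqrt T) * (1 / 256 * (T : ℝ) ^ (g / 3))
        ≤ (Real.sqrt N * Real.sqrt T) * (B * Real.log ((N : ℝ) * T) ^ C) := by
      linarith
    have hfin := le_of_mul_le_mul_left hub' hs
    have h1 := mul_le_mul_of_nonneg_left hlogC hB.le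
    have h2 := mul_lt_mul_of_pos_right hbig hyC
    nlinarith
  · refine le_trans ?_ hsw
    have hlogT : Real.logb 2 (T : ℝ) ≤ 2 * y := by
      have := Real.logb_le_logb_of_le (b := 2) (by norm_num) hTpos hT2r
      rwa [Real.logb_pow] at this
    have hloglog : l ≤ Real.logb 2 (Real.logb 2 ((N : ℝ) * T)) := by
      refine Real.logb_le_logb_of_le (by norm_num) hy0 ?_
      exact Real.logb_le_logb_of_le (by norm_num) (by linarith) (by nlinarith)
    have hlogg : Real.logb 2 (1 + g) ≤ 2 * g := by
      rw [Real.logb, div_le_iff₀ (Real.log_pos (by norm_num))]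
      have h1 := Real.log_le_sub_one_of_pos (x := 1 + g) (by linarith)
      have h2 := Real.log_two_gt_d9
      nlinarith
    have hlogg0 : 0 < Real.logb 2 (1 + g) := Real.logb_pos (by norm_num) (by linarith)
    calc 1 / 192 * ((N : ℝ) * Real.logb 2 (T : ℝ)
            / (C * Real.logb 2 (Real.logb 2 ((N : ℝ) * (T : ℝ)))))
        ≤ 1 / 192 * ((N : ℝ) * (2 * y) / (C * l)) := by gcongr
      _ = N / (8 * (2 * g)) := by
          rw [hg]
          field_simp
          norm_num
      _ ≤ N / (8 * Real.logb 2 (1 + g)) := by gcongr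

end MNLBandit

theorem mainTheorem2 :
    (∃ c : ℝ, 0 < c ∧ ∀ C : ℝ, 0 < C → ∀ B : ℝ, 0 < B → ∃ Tmin : ℕ,
      ∀ N : ℕ, 2 ≤ N → ∀ A : MNLBandit.AnytimeAlgorithm N,
      ∀ T₀ : ℕ, Tmin ≤ T₀ → N ≤ T₀ →
      (∀ (I : MNLBandit.Instance N) (T : ℕ), T₀ ≤ T → T ≤ T₀ ^ 2 →
        A.expectedRegret I T
          ≤ B * Real.sqrt ((N : ℝ) * (T : ℝ)) * Real.log ((N : ℝ) * (T : ℝ)) ^ C) →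
      ∃ (I : MNLBandit.Instance N) (T : ℕ), T₀ ≤ T ∧ T ≤ T₀ ^ 2 ∧
        c * ((N : ℝ) * Real.logb 2 (T : ℝ)
            / (C * Real.logb 2 (Real.logb 2 ((N : ℝ) * (T : ℝ)))))
          ≤ A.expectedSwitches I T) ∧
    (∀ N : ℕ, 2 ≤ N → ∀ T₀ : ℕ, 4 ≤ T₀ → N ≤ T₀ → ∀ g : ℕ → ℝ,
      (∀ T : ℕ, T₀ ≤ T → 3 / Real.logb 2 (T : ℝ) ≤ g T ∧ g T ≤ 1 / 2) →
      (∀ T T' : ℕ, T₀ ≤ T → T ≤ T' → g T' ≤ g T) →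
      ∀ A : MNLBandit.AnytimeAlgorithm N,
      ∃ (I : MNLBandit.Instance N) (T : ℕ), T₀ ≤ T ∧ T ≤ T₀ ^ 2 ∧
        (1 / 7525 * Real.sqrt (N : ℝ) * (T : ℝ) ^ ((1 : ℝ) / 2 + g (T₀ ^ 2) / 3)
            ≤ A.expectedRegret I T ∨
          (N : ℝ) / (8 * Real.logb 2 (1 + g T)) ≤ A.expectedSwitches I T)) := by
  refine ⟨⟨1 / 192, by norm_num, fun C hC B hB => MNLBandit.exists_switches_of_regret_le hC hB⟩, ?_⟩
  intro N hN T₀ hT₀ hNT₀ g hg hmono A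
  -- the constant exponent `g (T₀ ^ 2)` bounds `g` from below on `[T₀, T₀ ^ 2]`
  have hT₀r : (4 : ℝ) ≤ T₀ := by exact_mod_cast hT₀
  have hT₀sq : T₀ ≤ T₀ ^ 2 := Nat.le_self_pow (by norm_num) T₀
  obtain ⟨hglow, hgupp⟩ := hg (T₀ ^ 2) hT₀sq
  have hlog0 : 0 < Real.logb 2 (T₀ : ℝ) := Real.logb_pos (by norm_num) (by linarith)
  rw [Nat.cast_pow, Real.logb_pow, div_le_iff₀ (by push_cast; linarith)] at hglow
  push_cast at hglow
  have hg0 : 0 < g (T₀ ^ 2) := by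
    by_contra hneg
    nlinarith
  obtain ⟨I, T, hT0, hT2, hor⟩ :=
    MNLBandit.regret_or_switches_of_const hN hT₀ hNT₀ hg0 hgupp (by linarith) A
  refine ⟨I, T, hT0, hT2, hor.imp (fun h => le_trans ?_ h) fun h => le_trans ?_ h⟩
  · rw [mul_assoc, mul_assoc]
    exact mul_le_mul_of_nonneg_right (by norm_num) (by positivity)
  · have hle : g (T₀ ^ 2) ≤ g T := hmono T (T₀ ^ 2) hT0 hT2
    have hlogpos : 0 < Real.logb 2 (1 + g (T₀ ^ 2)) := Real.logb_pos (by norm_num) (by linarith)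
    have hloglow : Real.logb 2 (1 + g (T₀ ^ 2)) ≤ Real.logb 2 (1 + g T) :=
      Real.logb_le_logb_of_le (by norm_num) (by linarith) (by linarith)
    gcongr
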